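/- Let $P$ be the transition matrix of a time-reversible ergodic (irreducible and aperiodic) Markov chain on $\{0,1,\dots,n\}$ with stationary distribution $\pi$ (a row vector). Let $P_0$ be $P$ with row $0$ and column $0$ deleted. All eigenvalues of $P$ and $P_0$ are real; consider the spectra $\sigma(P)$ and $\sigma(P_0)$ as multisets and remove the multiset $\sigma(P)\cap\sigma(P_0)$ from each. Denote the remaining (reduced) eigenvalues of $P$ by $\lambda_0\ge\lambda_1\ge\dots\ge\lambda_r$ and those of $P_0$ by $\gamma_1\ge\dots\ge\gamma_r$ (these strictly interlace: $1=\lambda_0>\gamma_1>\lambda_1>\dots>\gamma_r>\lambda_r>-1$), and assume $\lambda_r\ge 0$. Put $\rho_i=\frac{1-\gamma_i}{1-\lambda_i}$ for $1\le i\le r$, and define a row vector $\pi^*$ on $\{0,\dots,r\}$ by $$\pi^*(0)=\prod_{j=1}^r\rho_j,\qquad \pi^*(i)=(1-\rho_i)\prod_{1\le j\le r,\ j\ne i}\frac{1-\gamma_j-\rho_j(1-\gamma_i)}{\gamma_i-\gamma_j}\quad(1\le i\le r).$$ Let $P^*$ be the star-chain matrix on $\{0,\dots,r\}$ given, for $1\le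 i\le r$, by $P^*(i,0)=1-\gamma_i$, $P^*(i,i)=\gamma_i$, $P^*(0,i)=\frac{(1-\gamma_i)\pi^*(i)}{\pi^*(0)}$, $P^*(0,0)=1-\frac1{\pi^*(0)}\sum_{i=1}^r(1-\gamma_i)\pi^*(i)$, with all other entries $0$. Let $P_{\mathrm{abs}}$ and $P^*_{\mathrm{abs}}$ be obtained from $P$ and $P^*$ by replacing row $0$ by $\delta_0=(1,0,\dots,0)$. Then there exists a real $(r+1)\times(n+1)$ matrix $\Lambda_1$ (not necessarily nonnegative) with all row sums equal to $1$ such that $$\pi=\pi^*\Lambda_1,\qquad \Lambda_1P_{\mathrm{abs}}=P^*_{\mathrm{abs}}\Lambda_1,\qquad \Lambda_1\delta_0^T=\delta_0^T,$$ that is, $\Lambda_1$ provides a quasi-intertwining of $(\pi,P_{\mathrm{abs}})$ and $(\pi^*,P^*_{\mathrm{abs}})$ whose column $0$ is $\delta_0^T$. Moreover $\Lambda_1$ can be chosen so that its row $0$ is $\delta_0$ and, for $1\le i\le r$, its row $i$ is $\delta_0+(-v_i\vec 1^{\,T}\mid v_i)$, where $v_i\in\mathbb R^n$ is a left eigenvector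 of $P_0$ with eigenvalue $\gamma_i$. -/

import Mathlib

noncomputable section

namespace StarLink

/-- The submatrix `A₀` obtained by deleting row `0` and column `0`. -/
def delZero {n : ℕ} (A : Matrix (Fin (n + 1)) (Fin (n + 1)) ℝ) : Matrix (Fin n) (Fin n) ℝ :=
  A.submatrix Fin.succ Fin.succ

/-- The matrix obtained by turning state `0` into an absorbing state: row `0` is replaced by the
row vector `δ₀`. -/
def absorb {n : ℕ} (A : Matrix (Fin (n + 1)) (Fin (n + 1)) ℝ) :
    Matrix (Fin (n + 1)) (Fin (n + 1)) ℝ :=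
  A.updateRow 0 (Pi.single 0 1)

/-- The multiset of real eigenvalues of `A`, with algebraic multiplicities. (It is only used for
matrices all of whose eigenvalues are real.) -/
def spec {m : ℕ} (A : Matrix (Fin m) (Fin m) ℝ) : Multiset ℝ := A.charpoly.roots

/-- The eigenvalues of `P` left after removing the multiset `σ(P) ∩ σ(P₀)` from `σ(P)`. -/
def redSpec {n : ℕ} (P : Matrix (Fin (n + 1)) (Fin (n + 1)) ℝ) : Multiset ℝ :=
  spec P - spec P ∩ spec (delZero P)

/-- The eigenvalues of `P₀` left after removing the multiset `σ(P) ∩ σ(P₀)` from `σ(P₀)`. -/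
def redSpecZero {n : ℕ} (P : Matrix (Fin (n + 1)) (Fin (n + 1)) ℝ) : Multiset ℝ :=
  spec (delZero P) - spec P ∩ spec (delZero P)

/-- The number `r` of reduced eigenvalues of `P₀`. -/
def numRed {n : ℕ} (P : Matrix (Fin (n + 1)) (Fin (n + 1)) ℝ) : ℕ := (redSpecZero P).card

/-- The reduced eigenvalues `γ₁ ≥ ⋯ ≥ γ_r` of `P₀`; here `γ_{i+1}` is `redGamma P i`. -/
def redGamma {n : ℕ} (P : Matrix (Fin (n + 1)) (Fin (n + 1)) ℝ) (i : Fin (numRed P)) : ℝ :=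
  ((redSpecZero P).sort (· ≥ ·)).get (i.cast (Multiset.length_sort (· ≥ ·)).symm)

/-- The reduced eigenvalues `λ₀ ≥ ⋯ ≥ λ_r` of `P`. (For a reversible chain `σ(P)` and `σ(P₀)`
have `n + 1` and `n` elements, so that the list has length `r + 1` and the default value of `getD`
is never used.) -/
def redLambda {n : ℕ} (P : Matrix (Fin (n + 1)) (Fin (n + 1)) ℝ) (i : Fin (numRed P + 1)) : ℝ :=
  ((redSpec P).sort (· ≥ ·)).getD i 0

section Star

/-! For the star chain, `gam i` stands for `γ_{i+1}` and belongs to the spoke `i.succ`, while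
`lam` is indexed from `0` to `r`. -/

variable {r : ℕ} (lam : Fin (r + 1) → ℝ) (gam : Fin r → ℝ)

/-- `ρ_i = (1 - γ_i) / (1 - λ_i)`, for `i = 1, …, r`. -/
def rho (i : Fin r) : ℝ := (1 - gam i) / (1 - lam i.succ)

/-- The distribution `π*` on the states `0, …, r` of the star. -/
def starPi : Fin (r + 1) → ℝ :=
  Fin.cons (∏ j, rho lam gam j) fun i =>
    (1 - rho lam gam i) *
      ∏ j ∈ Finset.univ.erase i,
        (1 - gam j - rho lam gam j * (1 - gam i)) / (gam i - gam j)

/-- The transition matrix `P*` of the star chain with hub `0`: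
`P*(0,0) = 1 - π*(0)⁻¹ ∑ i, (1 - γ_i) π*(i)`, `P*(0,i) = (1 - γ_i) π*(i) / π*(0)`,
`P*(i,0) = 1 - γ_i`, `P*(i,i) = γ_i`, and all other entries vanish. -/
def starP : Matrix (Fin (r + 1)) (Fin (r + 1)) ℝ :=
  Matrix.of (Fin.cons
    (Fin.cons
      (1 - 1 / starPi lam gam 0 * ∑ i, (1 - gam i) * starPi lam gam i.succ)
      fun i => (1 - gam i) * starPi lam gam i.succ / starPi lam gam 0)
    fun i => Fin.cons (1 - gam i) fun j => if i = j then gam i else 0)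

end Star

/-- `Λ` (rows summing to one, not necessarily nonnegative) is a quasi-link providing a
quasi-intertwining of `(π, P)` and `(π', P')`. -/
structure IsQuasiIntertwining {a b : ℕ} (pi : Fin a → ℝ) (P : Matrix (Fin a) (Fin a) ℝ)
    (pi' : Fin b → ℝ) (P' : Matrix (Fin b) (Fin b) ℝ) (L : Matrix (Fin b) (Fin a) ℝ) : Prop where
  row_sum : ∀ i, ∑ j, L i j = 1
  comm : L * P = P' * L
  init : pi = Matrix.vecMul pi' L

end StarLink

end

namespace StarLink

open Matrix Polynomial

/-! Conjugation by `√π` makes `P₀` symmetric, so row `0` of `P` off state `0` is a sum of left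
eigenvectors `u g` of `P₀`, one for each `g` in a finite set `G`, with `W g = u g · P(·,0) > 0`. A
Schur complement then gives `χ_P(t) = χ_{P₀}(t) (t - P(0,0) - ∑ W g / (t - g))`, and since rows of
`P` sum to one the bracket is `(t - 1) (1 + ∑ W g / ((1 - g)(t - g)))`. Clearing denominators yields
`χ_P = c (X - 1) m` and `χ_{P₀} = c ∏ (X - g)`, where `m` (`secular`) vanishes nowhere on `G`. Hence
the reduced `γ`'s are `G` and the reduced `λ`'s are `1` and the roots of `m`
(`redSpec_of_factorization`).

Evaluating `m` at `1` and at `γ_i` turns the products in `π*` into `π*(0) = π(0)` and `π*(i) = π(0)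
W_i / (1 - γ_i)²` (`starPi_eq`). Off state `0`, moreover, `π = π(0) ∑ u g / (1 - g)`
(`stationary_eq_sum`). Taking `v_i` to be `u (γ_i)` scaled to total mass one gives `π = π* Λ₁`. The
commutation relation only uses that `v_i` is a left eigenvector of `P₀`. -/

/-! ### Linear algebra: spectral decomposition and Schur complement. -/

/-- A vector is a sum of eigenvectors of a real symmetric matrix `A`, one for each eigenvalue in a
finite set, each of them positively correlated with the vector. -/
theorem exists_eigenvector_decomposition {n : ℕ} {A : Matrix (Fin n) (Fin n) ℝ}
    (hA : A.IsHermitian) (b : Fin n → ℝ) :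
    ∃ (G : Finset ℝ) (B : ℝ → Fin n → ℝ),
      (∀ g ∈ G, A *ᵥ B g = g • B g ∧ 0 < B g ⬝ᵥ b) ∧ ∑ g ∈ G, B g = b := by
  classical
  set e : Fin n → Fin n → ℝ := fun k => ⇑(hA.eigenvectorBasis k) with he
  set d := hA.eigenvalues
  set a : Fin n → ℝ := fun k => e k ⬝ᵥ b with ha
  have hsum : ∑ k, a k • e k = b := by
    have h := hA.eigenvectorBasis.sum_repr' (WithLp.toLp 2 b)
    have h' := congrArg (WithLp.ofLp) h
    rw [WithLp.ofLp_sum] at h'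
    simp only [WithLp.ofLp_smul] at h'
    refine Eq.trans (Finset.sum_congr rfl fun k _ => ?_) h'
    congr 1
    simp [ha, he, PiLp.inner_apply, dotProduct, mul_comm]
  -- Zero coefficients are dropped so that each correlation, a sum of squares `a k ^ 2`, is strictly
  -- positive.
  let S : Finset (Fin n) := Finset.univ.filter fun k => a k ≠ 0
  refine ⟨S.image d, fun g => ∑ k ∈ S with d k = g, a k • e k, ?_, ?_⟩
  · intro g hg
    obtain ⟨k, hk, rfl⟩ := Finset.mem_image.1 hg
    constructor
    · rw [mulVec_sum, Finset.smul_sum]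
      refine Finset.sum_congr rfl fun l hl => ?_
      rw [mulVec_smul, hA.mulVec_eigenvectorBasis, ← (Finset.mem_filter.1 hl).2, smul_comm]
    · rw [sum_dotProduct]
      refine Finset.sum_pos (fun l hl => ?_) ⟨k, by simp [hk]⟩
      have : a l ≠ 0 := by
        have := (Finset.mem_filter.1 hl).1
        simpa [S] using this
      rw [smul_dotProduct, smul_eq_mul]
      exact mul_self_pos.2 this
  · rw [Finset.sum_fiberwise_of_maps_to (fun k hk => Finset.mem_image_of_mem d hk), ← hsum]
    exact Finset.sum_subset (Finset.subset_univ _) fun k _ hk => by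
      have : a k = 0 := by simpa [S] using hk
      rw [this, zero_smul]

/-- Expansion of a characteristic polynomial along row `0`. -/
theorem eval_charpoly_eq_mul_delZero {n : ℕ} (P : Matrix (Fin (n + 1)) (Fin (n + 1)) ℝ)
    (t : ℝ) (x : Fin n → ℝ)
    (hx : x ᵥ* (scalar (Fin n) t - delZero P) = fun j => P 0 j.succ) :
    P.charpoly.eval t =
      (delZero P).charpoly.eval t * (t - P 0 0 - x ⬝ᵥ fun j => P j.succ 0) := by
  rw [eval_charpoly, eval_charpoly]
  set A := scalar (Fin (n + 1)) t - P with hA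
  -- Adding the combination `x` of the other rows to row `0` clears that row off the diagonal.
  have h := det_updateRow_sum A 0 (Fin.cons 1 x)
  rw [Fin.cons_zero, one_smul] at h
  have hrow : (∑ k, (Fin.cons 1 x : Fin (n + 1) → ℝ) k • A k) =
      Fin.cons (t - P 0 0 - x ⬝ᵥ fun j => P j.succ 0) 0 := by
    funext j
    rw [Fin.sum_univ_succ]
    refine Fin.cases ?_ (fun j => ?_) j
    · simp [hA, dotProduct, scalar_apply, sub_eq_add_neg]
    · have := congrFun hx j
      simp only [vecMul, dotProduct, delZero] at this
      simp only [Fin.cons_zero, Fin.cons_succ, Pi.add_apply, Finset.sum_apply, Pi.smul_apply,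
        smul_eq_mul, one_mul, Pi.zero_apply]
      simp only [hA, scalar_apply, diagonal_apply, Matrix.sub_apply, submatrix_apply, Fin.succ_inj,
        (Fin.succ_ne_zero j).symm, if_false] at this ⊢
      linarith
  rw [← h, hrow, det_succ_row_zero, Fin.sum_univ_succ]
  have hsub : (A.updateRow 0 (Fin.cons (t - P 0 0 - x ⬝ᵥ fun j => P j.succ 0) 0)).submatrix
      Fin.succ (Fin.succAbove 0) = scalar (Fin n) t - delZero P := by
    ext i j
    simp [hA, delZero, scalar_apply, diagonal_apply, updateRow_apply]
  rw [hsub]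
  simp [mul_comm]

/-! ### Ergodic and reversible chains. -/

section Chain

variable {n : ℕ} {P : Matrix (Fin (n + 1)) (Fin (n + 1)) ℝ} {pi : Fin (n + 1) → ℝ}

theorem vecMul_pow_of_fixed {u : Fin (n + 1) → ℝ} (hu : u ᵥ* P = u) (k : ℕ) :
    u ᵥ* P ^ k = u := by
  induction k with
  | zero => simp
  | succ k ih => rw [pow_succ, ← vecMul_vecMul, ih, hu]

theorem stationary_pos (hErg : P.IsPrimitive) (hpi : pi ∈ stdSimplex ℝ (Fin (n + 1)))
    (hstat : pi ᵥ* P = pi) (i : Fin (n + 1)) : 0 < pi i := by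
  obtain ⟨k, -, hk⟩ := hErg.exists_pos_pow
  have h := congrFun (vecMul_pow_of_fixed hstat k) i
  obtain ⟨j, -, hj⟩ : ∃ j ∈ Finset.univ, 0 < pi j :=
    Finset.exists_lt_of_sum_lt (f := fun _ => (0 : ℝ)) (by rw [hpi.2]; norm_num)
  rw [← h, vecMul, dotProduct]
  exact Finset.sum_pos' (fun l _ => mul_nonneg (hpi.1 l) (hk l i).le)
    ⟨j, Finset.mem_univ _, mul_pos hj (hk j i)⟩

theorem sum_vecMul_of_rowStochastic (hP : P ∈ rowStochastic ℝ (Fin (n + 1)))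
    (u : Fin (n + 1) → ℝ) : ∑ j, (u ᵥ* P) j = ∑ j, u j := by
  simp only [vecMul, dotProduct]
  rw [Finset.sum_comm]
  simp [← Finset.mul_sum, sum_row_of_mem_rowStochastic hP]

theorem abs_vecMul_le (hP : P ∈ rowStochastic ℝ (Fin (n + 1))) (u : Fin (n + 1) → ℝ)
    (j : Fin (n + 1)) : |(u ᵥ* P) j| ≤ ((fun i => |u i|) ᵥ* P) j := by
  rw [vecMul, vecMul, dotProduct, dotProduct]
  refine (Finset.abs_sum_le_sum_abs _ _).trans (Finset.sum_le_sum fun i _ => ?_)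
  rw [abs_mul, abs_of_nonneg (nonneg_of_mem_rowStochastic hP)]

/-- A fixed row vector of an ergodic chain with a vanishing entry is zero. -/
theorem eq_zero_of_fixed (hP : P ∈ rowStochastic ℝ (Fin (n + 1))) (hErg : P.IsPrimitive)
    {u : Fin (n + 1) → ℝ} (hu : u ᵥ* P = u) (h0 : u 0 = 0) : u = 0 := by
  obtain ⟨k, -, hk⟩ := hErg.exists_pos_pow
  have hle : ∀ j, |u j| ≤ ((fun i => |u i|) ᵥ* P ^ k) j := fun j => by
    have := abs_vecMul_le (pow_mem hP k) u j
    rwa [vecMul_pow_of_fixed hu k] at this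
  -- `|u| ≤ |u| P ^ k` entrywise with equal totals forces equality; at state `0`, positivity of
  -- column `0` of `P ^ k` then kills every entry.
  have heq := (Finset.sum_eq_sum_iff_of_le fun j _ => hle j).1
    (sum_vecMul_of_rowStochastic (pow_mem hP k) fun i => |u i|).symm 0 (Finset.mem_univ _)
  rw [h0, abs_zero, eq_comm, vecMul, dotProduct] at heq
  have := (Finset.sum_eq_zero_iff_of_nonneg
    fun i _ => mul_nonneg (abs_nonneg (u i)) (hk i 0).le).1 heq
  funext i
  simpa [(hk i 0).ne'] using this i (Finset.mem_univ _)

/-- Row vectors do not grow in `ℓ¹` norm under a stochastic matrix. This bound puts the eigenvalue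
`1` first in the sorted list. -/
theorem le_one_of_mem_roots_charpoly (hP : P ∈ rowStochastic ℝ (Fin (n + 1))) {μ : ℝ}
    (hμ : P.charpoly.IsRoot μ) : μ ≤ 1 := by
  rw [IsRoot.def, eval_charpoly, ← exists_vecMul_eq_zero_iff] at hμ
  obtain ⟨v, hv, h⟩ := hμ
  rw [vecMul_sub, sub_eq_zero] at h
  have hv' : v ᵥ* P = μ • v := by
    rw [← h]; funext j; simp [scalar_apply, vecMul_diagonal, mul_comm]
  have hpos : 0 < ∑ j, |v j| := by
    obtain ⟨j, hj⟩ := Function.ne_iff.1 hv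
    exact Finset.sum_pos' (fun _ _ => abs_nonneg _) ⟨j, Finset.mem_univ _, abs_pos.2 hj⟩
  have hle : ∑ j, |μ| * |v j| ≤ ∑ j, |v j| := by
    rw [← sum_vecMul_of_rowStochastic hP fun j => |v j|]
    refine Finset.sum_le_sum fun j _ => ?_
    have := abs_vecMul_le hP v j
    rwa [hv', Pi.smul_apply, smul_eq_mul, abs_mul] at this
  rw [← Finset.mul_sum] at hle
  exact (le_abs_self μ).trans (le_of_mul_le_mul_right (by linarith) hpos)

/-- Conjugation of `P` by the square root of the diagonal matrix of `pi`. -/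
noncomputable def symmetrized (P : Matrix (Fin (n + 1)) (Fin (n + 1)) ℝ) (pi : Fin (n + 1) → ℝ) :
    Matrix (Fin (n + 1)) (Fin (n + 1)) ℝ :=
  Matrix.of fun i j => √(pi i) * P i j * (√(pi j))⁻¹

theorem symmetrized_isHermitian (hpos : ∀ i, 0 < pi i) (hrev : ∀ i j, pi i * P i j = pi j * P j i) :
    (symmetrized P pi).IsHermitian := by
  ext i j
  have hi := Real.sqrt_pos.2 (hpos i)
  have hj := Real.sqrt_pos.2 (hpos j)
  have h := hrev i j
  rw [← Real.sq_sqrt (hpos i).le, ← Real.sq_sqrt (hpos j).le] at h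
  simp only [symmetrized, conjTranspose_apply, of_apply, star_trivial]
  field_simp
  linarith

theorem charpoly_symmetrized (hpos : ∀ i, 0 < pi i) :
    (symmetrized P pi).charpoly = P.charpoly := by
  have h1 : ∀ i, √(pi i) ≠ 0 := fun i => (Real.sqrt_pos.2 (hpos i)).ne'
  have : symmetrized P pi =
      diagonal (fun i => √(pi i)) * (P * diagonal (fun i => (√(pi i))⁻¹)) := by
    ext i j
    simp [symmetrized, mul_assoc]
  rw [this, charpoly_mul_comm, mul_assoc, diagonal_mul_diagonal]
  simp [h1]

theorem splits_charpoly_of_reversible (hpos : ∀ i, 0 < pi i)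
    (hrev : ∀ i j, pi i * P i j = pi j * P j i) : P.charpoly.Splits := by
  rw [← charpoly_symmetrized hpos]
  exact (symmetrized_isHermitian hpos hrev).splits_charpoly

/-- Row `0` of a reversible chain is a sum of left eigenvectors of `P₀`. -/
theorem exists_left_eigenvector_decomposition (hpos : ∀ i, 0 < pi i)
    (hrev : ∀ i j, pi i * P i j = pi j * P j i) :
    ∃ (G : Finset ℝ) (u : ℝ → Fin n → ℝ),
      (∀ g ∈ G, u g ᵥ* delZero P = g • u g ∧ 0 < u g ⬝ᵥ fun j => P j.succ 0) ∧
      ∑ g ∈ G, u g = fun j => P 0 j.succ := by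
  set s : Fin (n + 1) → ℝ := fun i => √(pi i) with hs
  have hs0 : ∀ i, 0 < s i := fun i => Real.sqrt_pos.2 (hpos i)
  have hsq : ∀ i, pi i = s i * s i := fun i => (Real.mul_self_sqrt (hpos i).le).symm
  have hH : (delZero (symmetrized P pi)).IsHermitian :=
    (symmetrized_isHermitian hpos hrev).submatrix _
  obtain ⟨G, B, hB, hsum⟩ := exists_eigenvector_decomposition hH
    fun j => P 0 j.succ / s j.succ
  refine ⟨G, fun g j => B g j * s j.succ, fun g hg => ⟨?_, ?_⟩, ?_⟩
  · have h := (hB g hg).1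
    rw [← vecMul_transpose] at h
    have hT : (delZero (symmetrized P pi))ᵀ = delZero (symmetrized P pi) := by
      simpa using hH.eq
    rw [hT] at h
    funext j
    have hj := congrFun h j
    simp only [vecMul, dotProduct, delZero, submatrix_apply, symmetrized, of_apply,
      Pi.smul_apply, smul_eq_mul] at hj ⊢
    rw [← mul_assoc, ← hj, Finset.sum_mul]
    refine Finset.sum_congr rfl fun i _ => ?_
    have := (hs0 j.succ).ne'
    change B g i * s i.succ * _ = B g i * (s i.succ * _ * (s j.succ)⁻¹) * s j.succ
    field_simp
  -- Detailed balance turns `π(0) P(0,j) / s j` into `s j * P(j,0)`, so positivity carries over from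
  -- the symmetric picture.
  · have h := mul_pos (hpos 0) (hB g hg).2
    rw [dotProduct, Finset.mul_sum] at h
    refine h.trans_eq (Finset.sum_congr rfl fun j _ => ?_)
    have h1 := hrev 0 j.succ
    rw [hsq j.succ] at h1
    have := (hs0 j.succ).ne'
    field_simp
    linear_combination B g j * h1
  · funext j
    have := congrFun hsum j
    rw [Finset.sum_apply] at this ⊢
    rw [← Finset.sum_mul, this, div_mul_cancel₀ _ (hs0 j.succ).ne']

end Chain


/-! ### The secular polynomial. -/

/-- The numerator of `1 + ∑ g ∈ G, W g / ((X - g) (1 - g))`. -/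
noncomputable def secular (G : Finset ℝ) (W : ℝ → ℝ) : ℝ[X] :=
  ∏ g ∈ G, (X - C g) + ∑ g ∈ G, C (W g / (1 - g)) * ∏ h ∈ G.erase g, (X - C h)

theorem eval_secular (G : Finset ℝ) (W : ℝ → ℝ) (t : ℝ) :
    (secular G W).eval t =
      ∏ g ∈ G, (t - g) + ∑ g ∈ G, W g / (1 - g) * ∏ h ∈ G.erase g, (t - h) := by
  simp [secular, eval_prod, eval_finsetSum]

theorem eval_secular_of_notMem {G : Finset ℝ} (W : ℝ → ℝ) {t : ℝ} (ht : t ∉ G) :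
    (secular G W).eval t =
      (∏ g ∈ G, (t - g)) * (1 + ∑ g ∈ G, W g / ((1 - g) * (t - g))) := by
  rw [eval_secular, mul_add, mul_one, Finset.mul_sum]
  congr 1
  refine Finset.sum_congr rfl fun g hg => ?_
  have : t - g ≠ 0 := sub_ne_zero.2 fun h => ht (h ▸ hg)
  rw [← Finset.mul_prod_erase G (fun g => t - g) hg, ← div_div]
  field_simp

theorem eval_secular_of_mem {G : Finset ℝ} (W : ℝ → ℝ) {t : ℝ} (ht : t ∈ G) :
    (secular G W).eval t = W t / (1 - t) * ∏ h ∈ G.erase t, (t - h) := by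
  rw [eval_secular, Finset.prod_eq_zero ht (sub_self t), zero_add]
  refine Finset.sum_eq_single_of_mem t ht fun g _ hg => ?_
  rw [Finset.prod_eq_zero (Finset.mem_erase.2 ⟨hg.symm, ht⟩) (sub_self t), mul_zero]

/-- This ensures that exactly the common factor `c` cancels between the two spectra. -/
theorem eval_secular_ne_zero {G : Finset ℝ} {W : ℝ → ℝ} {g : ℝ} (hg : g ∈ G)
    (hG1 : ∀ g ∈ G, g ≠ 1) (hW : ∀ g ∈ G, 0 < W g) : (secular G W).eval g ≠ 0 := by
  rw [eval_secular_of_mem W hg]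
  refine mul_ne_zero (div_ne_zero (hW g hg).ne' (sub_ne_zero.2 (hG1 g hg).symm)) ?_
  exact Finset.prod_ne_zero_iff.2 fun h hh => sub_ne_zero.2 (Finset.ne_of_mem_erase hh).symm

/-- The sorted list of a multiset of known cardinality enumerates it. -/
theorem prod_getD_sort (s : Multiset ℝ) {r : ℕ} (hr : Multiset.card s = r) (f : ℝ → ℝ) :
    ∏ i : Fin r, f ((s.sort (· ≥ ·)).getD i 0) = (s.map f).prod := by
  subst hr
  set l := s.sort (· ≥ ·) with hl
  have hs : (l : Multiset ℝ) = s := s.sort_eq _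
  have hlen : l.length = s.card := Multiset.length_sort _
  have hprod : (s.map f).prod = ∏ i : Fin l.length, f l[i.1] := by
    conv_lhs => rw [← hs]
    rw [Multiset.map_coe, Multiset.prod_coe, ← Fin.prod_univ_fun_getElem]
  rw [hprod]
  refine Fintype.prod_equiv (finCongr hlen.symm) _ _ fun i => ?_
  rw [List.getD_eq_getElem _ _ (by rw [hlen]; exact i.2)]
  rfl

/-! ### Characteristic polynomials and reduced spectra. -/

section Spectra

variable {n : ℕ} {P : Matrix (Fin (n + 1)) (Fin (n + 1)) ℝ} {pi : Fin (n + 1) → ℝ}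
  {G : Finset ℝ} {u : ℝ → Fin n → ℝ}

/-- Summing the eigenvector equation over states: mass missing after one step of `P₀` has jumped to
state `0`. -/
theorem sum_mul_one_sub (hP : P ∈ rowStochastic ℝ (Fin (n + 1))) {g : ℝ} {v : Fin n → ℝ}
    (hv : v ᵥ* delZero P = g • v) : (∑ j, v j) * (1 - g) = v ⬝ᵥ fun j => P j.succ 0 := by
  have h : ∑ j, (v ᵥ* delZero P) j = g * ∑ j, v j := by rw [hv, Finset.mul_sum]; rfl
  simp only [vecMul, dotProduct, delZero, submatrix_apply] at h ⊢
  rw [Finset.sum_comm] at h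
  have h2 : ∀ i : Fin n, v i * P i.succ 0 + ∑ j : Fin n, v i * P i.succ j.succ = v i := fun i => by
    rw [← Finset.mul_sum, ← mul_add, ← Fin.sum_univ_succ, sum_row_of_mem_rowStochastic hP, mul_one]
  have h3 := Finset.sum_congr (rfl : (Finset.univ : Finset (Fin n)) = _) fun i _ => h2 i
  rw [Finset.sum_add_distrib] at h3
  linarith

theorem ne_one_of_pos (hP : P ∈ rowStochastic ℝ (Fin (n + 1))) {g : ℝ} {v : Fin n → ℝ}
    (hv : v ᵥ* delZero P = g • v) (hpos : 0 < v ⬝ᵥ fun j => P j.succ 0) : g ≠ 1 := by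
  rintro rfl
  rw [← sum_mul_one_sub hP hv] at hpos
  simp at hpos

theorem isRoot_charpoly_of_vecMul {m : ℕ} {A : Matrix (Fin m) (Fin m) ℝ} {g : ℝ}
    {v : Fin m → ℝ} (hv0 : v ≠ 0) (hv : v ᵥ* A = g • v) : A.charpoly.IsRoot g := by
  rw [IsRoot.def, eval_charpoly, ← exists_vecMul_eq_zero_iff]
  refine ⟨v, hv0, ?_⟩
  rw [vecMul_sub, hv, sub_eq_zero]
  funext j
  simp [scalar_apply, vecMul_diagonal, mul_comm]

theorem prod_dvd_charpoly_delZero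
    (hu : ∀ g ∈ G, u g ᵥ* delZero P = g • u g ∧ 0 < u g ⬝ᵥ fun j => P j.succ 0) :
    ∏ g ∈ G, (X - C g) ∣ (delZero P).charpoly := by
  have hne : (delZero P).charpoly ≠ 0 := (charpoly_monic _).ne_zero
  have := (Multiset.prod_X_sub_C_dvd_iff_le_roots hne G.val).2
    ((Multiset.le_iff_subset G.nodup).2 fun g hg => ?_)
  · exact this
  · refine (mem_roots hne).2 (isRoot_charpoly_of_vecMul ?_ (hu g hg).1)
    intro h0
    have := (hu g hg).2
    simp [h0] at this

theorem charpoly_eq_mul_secular (hP : P ∈ rowStochastic ℝ (Fin (n + 1)))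
    (hu : ∀ g ∈ G, u g ᵥ* delZero P = g • u g ∧ 0 < u g ⬝ᵥ fun j => P j.succ 0)
    (hsum : ∑ g ∈ G, u g = fun j => P 0 j.succ)
    {c : ℝ[X]} (hc : (delZero P).charpoly = c * ∏ g ∈ G, (X - C g)) :
    P.charpoly =
      c * ((X - C 1) * secular G fun g => u g ⬝ᵥ fun j => P j.succ 0) := by
  -- It suffices to compare values off the finite set `G`, where `t - g` is invertible.
  refine eq_of_infinite_eval_eq _ _ ((Finset.finite_toSet G).infinite_compl.mono fun t ht => ?_)
  have htG : t ∉ G := ht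
  have hne : ∀ g ∈ G, t - g ≠ 0 := fun g hg => sub_ne_zero.2 fun h => htG (h ▸ hg)
  have hne1 : ∀ g ∈ G, 1 - g ≠ 0 := fun g hg =>
    sub_ne_zero.2 (ne_one_of_pos hP (hu g hg).1 (hu g hg).2).symm
  have hx : (∑ g ∈ G, (t - g)⁻¹ • u g) ᵥ* (scalar (Fin n) t - delZero P) =
      fun j => P 0 j.succ := by
    rw [← hsum, sum_vecMul]
    refine Finset.sum_congr rfl fun g hg => ?_
    have : u g ᵥ* (scalar (Fin n) t) = t • u g := by
      funext j
      simp [scalar_apply, vecMul_diagonal, mul_comm]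
    rw [smul_vecMul, vecMul_sub, (hu g hg).1, this, ← sub_smul, inv_smul_smul₀ (hne g hg)]
  -- Row `0` summing to one is what lets the factor `t - 1` split off.
  have h00 : ∑ g ∈ G, (u g ⬝ᵥ fun j => P j.succ 0) / (1 - g) = 1 - P 0 0 := by
    have h1 := sum_row_of_mem_rowStochastic hP 0
    rw [Fin.sum_univ_succ] at h1
    have h2 : ∑ j, (∑ g ∈ G, u g) j = ∑ j : Fin n, P 0 j.succ := by rw [hsum]
    simp only [Finset.sum_apply] at h2
    rw [Finset.sum_comm] at h2
    rw [eq_sub_iff_add_eq']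
    refine Eq.trans ?_ h1
    rw [← h2]
    congr 1
    refine Finset.sum_congr rfl fun g hg => ?_
    rw [← sum_mul_one_sub hP (hu g hg).1, mul_div_cancel_right₀ _ (hne1 g hg)]
  have hev := eval_charpoly_eq_mul_delZero P t _ hx
  rw [Set.mem_ofPred_eq, hev, hc]
  simp only [eval_mul, eval_prod, eval_sub, eval_X, eval_C, eval_secular_of_notMem _ htG]
  have key : t - P 0 0 - (∑ g ∈ G, (t - g)⁻¹ • u g) ⬝ᵥ (fun j => P j.succ 0) =
      (t - 1) * (1 + ∑ g ∈ G, (u g ⬝ᵥ fun j => P j.succ 0) / ((1 - g) * (t - g))) := by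
    have : t - P 0 0 = t - 1 + (1 - P 0 0) := by ring
    rw [this, ← h00, sum_dotProduct, mul_add, mul_one, add_sub_assoc, ← Finset.sum_sub_distrib,
      Finset.mul_sum]
    congr 1
    refine Finset.sum_congr rfl fun g hg => ?_
    rw [smul_dotProduct, smul_eq_mul]
    have := hne g hg
    have := hne1 g hg
    field_simp
    ring
  rw [key]
  ring

/-- The reduced spectra, in terms of the decomposition of row `0` of `P` into left eigenvectors
of `P₀`. -/
theorem redSpec_of_factorization {c m : ℝ[X]} (hc : c.Monic) (hm : m.Monic)
    (h0 : (delZero P).charpoly = c * ∏ g ∈ G, (X - C g))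
    (h1 : P.charpoly = c * ((X - C 1) * m)) (hG1 : ∀ g ∈ G, g ≠ 1)
    (hGm : ∀ g ∈ G, m.eval g ≠ 0) :
    redSpecZero P = G.val ∧ redSpec P = 1 ::ₘ m.roots := by
  have hQ : (∏ g ∈ G, (X - C g)).roots = G.val := roots_prod_X_sub_C G
  have hQm : (∏ g ∈ G, (X - C g) : ℝ[X]).Monic := monic_prod_X_sub_C _ _
  have e0 : spec (delZero P) = c.roots + G.val := by
    rw [spec, h0, roots_mul (hc.mul hQm).ne_zero, hQ]
  have e1 : spec P = c.roots + (1 ::ₘ m.roots) := by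
    rw [spec, h1, roots_mul (hc.mul ((monic_X_sub_C 1).mul hm)).ne_zero,
      roots_mul ((monic_X_sub_C 1).mul hm).ne_zero, roots_X_sub_C, Multiset.singleton_add]
  have hdis : (1 ::ₘ m.roots) ∩ G.val = 0 := by
    rw [Multiset.inter_eq_zero_iff_disjoint]
    refine Multiset.disjoint_left.2 fun {x} hx hxG => ?_
    rcases Multiset.mem_cons.1 hx with rfl | hx
    · exact hG1 1 hxG rfl
    · exact hGm x hxG (isRoot_of_mem_roots hx)
  have hint : spec P ∩ spec (delZero P) = c.roots := by
    rw [e0, e1, ← Multiset.add_inter_distrib, hdis, add_zero]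
  rw [redSpecZero, redSpec, hint, e0, e1]
  exact ⟨add_tsub_cancel_left _ _, add_tsub_cancel_left _ _⟩

end Spectra


/-! ### Closed form of `π*`. -/

/-- The distribution `π*` in terms of the residues `W` of the secular equation. -/
theorem starPi_eq {r : ℕ} {lam : Fin (r + 1) → ℝ} {gam W : Fin r → ℝ} {c : ℝ}
    (hinj : Function.Injective gam) (hg1 : ∀ i, gam i ≠ 1)
    (h1 : ∏ i : Fin r, (1 - lam i.succ) =
      (∏ i, (1 - gam i)) * (1 + ∑ i, W i / (1 - gam i) ^ 2))
    (h2 : ∀ i, ∏ j : Fin r, (gam i - lam j.succ) =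
      W i / (1 - gam i) * ∏ j ∈ Finset.univ.erase i, (gam i - gam j))
    (hc : c * (1 + ∑ i, W i / (1 - gam i) ^ 2) = 1) :
    starPi lam gam 0 = c ∧ ∀ i : Fin r, starPi lam gam i.succ = c * W i / (1 - gam i) ^ 2 := by
  have hgam : ∀ i, 1 - gam i ≠ 0 := fun i => sub_ne_zero.2 (hg1 i).symm
  have hQ : ∏ i, (1 - gam i) ≠ 0 := Finset.prod_ne_zero_iff.2 fun i _ => hgam i
  have hL : ∏ i : Fin r, (1 - lam i.succ) ≠ 0 := by
    rw [h1]
    exact mul_ne_zero hQ (right_ne_zero_of_mul (hc.trans_ne one_ne_zero))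
  have hlam : ∀ i : Fin r, 1 - lam i.succ ≠ 0 := fun i =>
    Finset.prod_ne_zero_iff.1 hL i (Finset.mem_univ _)
  have hrho : ∏ j, rho lam gam j = c := by
    simp only [rho, Finset.prod_div_distrib]
    rw [div_eq_iff hL, h1]
    linear_combination -(∏ i, (1 - gam i)) * hc
  refine ⟨hrho, fun i => ?_⟩
  have hdiff : ∏ j ∈ Finset.univ.erase i, (gam i - gam j) ≠ 0 :=
    Finset.prod_ne_zero_iff.2 fun j hj =>
      sub_ne_zero.2 fun h => Finset.ne_of_mem_erase hj (hinj h).symm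
  have hW : W i = (1 - gam i) * (gam i - lam i.succ) *
      (∏ j ∈ Finset.univ.erase i, (gam i - lam j.succ)) /
        ∏ j ∈ Finset.univ.erase i, (gam i - gam j) := by
    have h := h2 i
    rw [← Finset.mul_prod_erase _ _ (Finset.mem_univ i)] at h
    rw [eq_div_iff hdiff, mul_assoc, h]
    have := hgam i
    field_simp
  -- By definition `1 - γ_j = ρ_j (1 - λ_j)`, so each numerator of `π*` factors.
  have hterm : ∀ j, 1 - gam j - rho lam gam j * (1 - gam i) =
      rho lam gam j * (gam i - lam j.succ) := fun j => by
    have := hlam j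
    simp only [rho]
    field_simp
    ring
  have hprod : starPi lam gam i.succ = (1 - rho lam gam i) *
      ((∏ j ∈ Finset.univ.erase i, rho lam gam j) *
        (∏ j ∈ Finset.univ.erase i, (gam i - lam j.succ)) /
          ∏ j ∈ Finset.univ.erase i, (gam i - gam j)) := by
    simp only [starPi, Fin.cons_succ, hterm, Finset.prod_div_distrib, Finset.prod_mul_distrib]
  rw [hprod, hW, ← hrho, ← Finset.mul_prod_erase _ _ (Finset.mem_univ i)]
  have := hgam i
  have := hlam i
  simp only [rho]
  field_simp
  ring

/-! ### The stationary distribution, the enumeration of `G`, and rows of the link. -/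

section Chain

variable {n : ℕ} {P : Matrix (Fin (n + 1)) (Fin (n + 1)) ℝ} {pi : Fin (n + 1) → ℝ}
  {G : Finset ℝ} {u : ℝ → Fin n → ℝ}

/-- The stationary distribution off state `0`, in terms of the decomposition of row `0` of `P`. -/
theorem stationary_eq_sum (hP : P ∈ rowStochastic ℝ (Fin (n + 1))) (hErg : P.IsPrimitive)
    (hstat : pi ᵥ* P = pi)
    (hu : ∀ g ∈ G, u g ᵥ* delZero P = g • u g ∧ 0 < u g ⬝ᵥ fun j => P j.succ 0)
    (hsum : ∑ g ∈ G, u g = fun j => P 0 j.succ) (j : Fin n) :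
    pi j.succ = ∑ g ∈ G, pi 0 / (1 - g) * u g j := by
  set w : Fin n → ℝ := ∑ g ∈ G, (pi 0 / (1 - g)) • u g with hw
  have hwP : w ᵥ* delZero P = w - pi 0 • fun j => P 0 j.succ := by
    rw [← hsum, hw, sum_vecMul, Finset.smul_sum, ← Finset.sum_sub_distrib]
    refine Finset.sum_congr rfl fun g hg => ?_
    have : 1 - g ≠ 0 := sub_ne_zero.2 (ne_one_of_pos hP (hu g hg).1 (hu g hg).2).symm
    rw [smul_vecMul, (hu g hg).1, smul_smul, ← sub_smul]
    congr 1
    field_simp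
    ring
  -- The discrepancy `d` is fixed by `P₀`, hence leaks no mass to state `0`; extended by `0` it is
  -- fixed by `P`, so it vanishes by ergodicity.
  set d : Fin n → ℝ := fun j => pi j.succ - w j with hd
  have hdP : d ᵥ* delZero P = d := by
    funext j
    have h1 := congrFun hstat j.succ
    have h2 := congrFun hwP j
    simp only [vecMul, dotProduct, Fin.sum_univ_succ, delZero, submatrix_apply, Pi.sub_apply,
      Pi.smul_apply, smul_eq_mul] at h1 h2 ⊢
    simp only [hd, sub_mul, Finset.sum_sub_distrib]
    linarith
  have h0 : d ⬝ᵥ (fun j => P j.succ 0) = 0 := by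
    rw [← sum_mul_one_sub hP (g := 1) (by rw [hdP, one_smul]), sub_self, mul_zero]
  have hfix : (Fin.cons 0 d : Fin (n + 1) → ℝ) ᵥ* P = Fin.cons 0 d := by
    funext k
    refine Fin.cases ?_ (fun k => ?_) k
    · simpa [vecMul, dotProduct, Fin.sum_univ_succ] using h0
    · simpa [vecMul, dotProduct, Fin.sum_univ_succ, delZero] using congrFun hdP k
  have := congrFun (eq_zero_of_fixed hP hErg hfix rfl) j.succ
  simp only [Fin.cons_succ, hd, Pi.zero_apply, sub_eq_zero] at this
  rw [this, hw]
  simp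

theorem stationary_zero_mul (hP : P ∈ rowStochastic ℝ (Fin (n + 1))) (hErg : P.IsPrimitive)
    (hpi : pi ∈ stdSimplex ℝ (Fin (n + 1))) (hstat : pi ᵥ* P = pi)
    (hu : ∀ g ∈ G, u g ᵥ* delZero P = g • u g ∧ 0 < u g ⬝ᵥ fun j => P j.succ 0)
    (hsum : ∑ g ∈ G, u g = fun j => P 0 j.succ) :
    pi 0 * (1 + ∑ g ∈ G, (u g ⬝ᵥ fun j => P j.succ 0) / (1 - g) ^ 2) = 1 := by
  have h1 := hpi.2
  rw [Fin.sum_univ_succ] at h1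
  refine Eq.trans ?_ h1
  simp only [stationary_eq_sum hP hErg hstat hu hsum]
  rw [Finset.sum_comm, mul_add, mul_one, Finset.mul_sum]
  congr 1
  refine Finset.sum_congr rfl fun g hg => ?_
  have : 1 - g ≠ 0 := sub_ne_zero.2 (ne_one_of_pos hP (hu g hg).1 (hu g hg).2).symm
  rw [← Finset.mul_sum, ← sum_mul_one_sub hP (hu g hg).1]
  field_simp

theorem redGamma_injective (h : redSpecZero P = G.val) : Function.Injective (redGamma P) := by
  intro i j hij
  have hnd : ((redSpecZero P).sort (· ≥ ·)).Nodup := by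
    rw [← Multiset.coe_nodup, Multiset.sort_eq, h]
    exact G.nodup
  exact Fin.cast_injective _ (hnd.injective_get hij)

theorem map_redGamma (h : redSpecZero P = G.val) :
    Finset.univ.map ⟨redGamma P, redGamma_injective h⟩ = G := by
  ext g
  rw [← Finset.mem_val (s := G), ← h, ← Multiset.mem_sort (r := (· ≥ ·)), List.mem_iff_get]
  simp only [Finset.mem_map, Finset.mem_univ, true_and, Function.Embedding.coeFn_mk, redGamma]
  exact ⟨fun ⟨i, hi⟩ => ⟨_, hi⟩, fun ⟨i, hi⟩ => ⟨i.cast (Multiset.length_sort _), hi⟩⟩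

/-- Rows of the form `δ₀ + (-v·1 | v)`, with `v` a left eigenvector of `P₀` for `g`, are mapped by
the absorbing chain to a mixture of themselves and `δ₀`. -/
theorem vecMul_absorb_of_eigenvector (hP : P ∈ rowStochastic ℝ (Fin (n + 1))) {g : ℝ}
    {v : Fin n → ℝ} (hv : v ᵥ* delZero P = g • v) :
    (Pi.single 0 1 + Fin.cons (-∑ j, v j) v : Fin (n + 1) → ℝ) ᵥ* absorb P =
      (1 - g) • Pi.single 0 1 + g • (Pi.single 0 1 + Fin.cons (-∑ j, v j) v) := by
  have h0 := sum_mul_one_sub hP hv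
  funext k
  refine Fin.cases ?_ (fun k => ?_) k
  · simp [vecMul, dotProduct, Fin.sum_univ_succ, absorb, updateRow_apply] at h0 ⊢
    linarith
  · simpa [vecMul, dotProduct, Fin.sum_univ_succ, absorb, updateRow_apply, delZero]
      using congrFun hv k

end Chain


/-! ### Identification of `π*` for the reduced eigenvalues of `P`. -/

theorem starPi_redLambda_redGamma {n : ℕ} {P : Matrix (Fin (n + 1)) (Fin (n + 1)) ℝ}
    {pi : Fin (n + 1) → ℝ} {G : Finset ℝ} {u : ℝ → Fin n → ℝ}
    (hP : P ∈ rowStochastic ℝ (Fin (n + 1))) (hErg : P.IsPrimitive)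
    (hpi : pi ∈ stdSimplex ℝ (Fin (n + 1))) (hstat : pi ᵥ* P = pi)
    (hrev : ∀ i j, pi i * P i j = pi j * P j i)
    (hu : ∀ g ∈ G, u g ᵥ* delZero P = g • u g ∧ 0 < u g ⬝ᵥ fun j => P j.succ 0)
    (hsum : ∑ g ∈ G, u g = fun j => P 0 j.succ) :
    redSpecZero P = G.val ∧ starPi (redLambda P) (redGamma P) 0 = pi 0 ∧
      ∀ i : Fin (numRed P), starPi (redLambda P) (redGamma P) i.succ =
        pi 0 * (u (redGamma P i) ⬝ᵥ fun j => P j.succ 0) / (1 - redGamma P i) ^ 2 := by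
  set W : ℝ → ℝ := fun g => u g ⬝ᵥ fun j => P j.succ 0 with hW
  set m := secular G W with hm
  obtain ⟨c, hc⟩ := prod_dvd_charpoly_delZero hu
  rw [mul_comm] at hc
  have hfac : P.charpoly = c * ((X - C 1) * m) := charpoly_eq_mul_secular hP hu hsum hc
  have hG1 : ∀ g ∈ G, g ≠ 1 := fun g hg => ne_one_of_pos hP (hu g hg).1 (hu g hg).2
  have hQmon : (∏ g ∈ G, (X - C g) : ℝ[X]).Monic := monic_prod_X_sub_C _ _
  have hcmon : c.Monic := Monic.of_mul_monic_right hQmon (hc ▸ charpoly_monic _)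
  have hmmon : m.Monic := Monic.of_mul_monic_left (monic_X_sub_C 1)
    (Monic.of_mul_monic_left hcmon (hfac ▸ charpoly_monic _))
  obtain ⟨hred0, hred⟩ := redSpec_of_factorization hcmon hmmon hc hfac hG1
    fun g hg => eval_secular_ne_zero hg hG1 fun g hg => (hu g hg).2
  have hpos := stationary_pos hErg hpi hstat
  have hPne : P.charpoly ≠ 0 := (charpoly_monic _).ne_zero
  have hmdvd : m ∣ P.charpoly := hfac ▸ Dvd.intro_left (c * (X - C 1)) (by ring)
  have hsplit : m.Splits := (splits_charpoly_of_reversible hpos hrev).of_dvd hPne hmdvd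
  have hnum : numRed P = G.card := by rw [numRed, hred0]; rfl
  -- The degree count, with `m` split over the reals by reversibility, keeps `getD` in `redLambda`
  -- away from its default value.
  have hcard : Multiset.card m.roots = numRed P := by
    rw [← hsplit.natDegree_eq_card_roots, hnum]
    have h1 := congrArg natDegree hfac
    have h2 := congrArg natDegree hc
    rw [charpoly_natDegree_eq_dim, Fintype.card_fin,
      hcmon.natDegree_mul ((monic_X_sub_C 1).mul hmmon), (monic_X_sub_C 1).natDegree_mul hmmon,
      natDegree_X_sub_C] at h1
    rw [charpoly_natDegree_eq_dim, Fintype.card_fin, hcmon.natDegree_mul hQmon,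
      natDegree_prod_of_monic _ _ fun g _ => monic_X_sub_C g] at h2
    simp only [natDegree_X_sub_C, Finset.sum_const, smul_eq_mul, mul_one] at h2
    omega
  -- Since `1` heads the list, the entries `redLambda P i.succ` enumerate exactly the roots of `m`.
  have hsort : (redSpec P).sort (· ≥ ·) = 1 :: m.roots.sort (· ≥ ·) := by
    rw [hred]
    refine Multiset.sort_cons _ _ _ fun x hx => ?_
    exact le_one_of_mem_roots_charpoly hP ((isRoot_of_mem_roots hx).dvd hmdvd)
  have heval : ∀ t, ∏ i : Fin (numRed P), (t - redLambda P i.succ) = m.eval t := fun t => by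
    have h := prod_getD_sort m.roots hcard fun x => t - x
    rw [hsplit.eval_eq_prod_roots_of_monic hmmon, ← h]
    simp [redLambda, hsort]
  have hG := map_redGamma hred0
  have hinj := redGamma_injective hred0
  have hmem : ∀ i, redGamma P i ∈ G := fun i => by
    rw [← hG]; exact Finset.mem_map_of_mem ⟨redGamma P, hinj⟩ (Finset.mem_univ i)
  have hsumG : ∀ f : ℝ → ℝ, ∑ g ∈ G, f g = ∑ i, f (redGamma P i) := fun f => by
    conv_lhs => rw [← hG]
    rw [Finset.sum_map]; rfl
  have hprodG : ∀ f : ℝ → ℝ, ∏ g ∈ G, f g = ∏ i, f (redGamma P i) := fun f => by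
    conv_lhs => rw [← hG]
    rw [Finset.prod_map]; rfl
  have herase : ∀ (i) (f : ℝ → ℝ), ∏ g ∈ G.erase (redGamma P i), f g =
      ∏ j ∈ Finset.univ.erase i, f (redGamma P j) := fun i f => by
    have : G.erase (redGamma P i) =
        (Finset.univ.erase i).map ⟨redGamma P, hinj⟩ := by
      rw [Finset.map_erase, hG]; rfl
    rw [this, Finset.prod_map]; rfl
  refine ⟨hred0, starPi_eq (W := fun i => W (redGamma P i)) hinj (fun i => hG1 _ (hmem i))
    ?_ (fun i => ?_) ?_⟩
  · rw [heval, hm, eval_secular_of_notMem W fun h => hG1 1 h rfl, hprodG, hsumG]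
    simp only [sq]
  · rw [heval, hm, eval_secular_of_mem W (hmem i), herase]
  · rw [← hsumG fun g => W g / (1 - g) ^ 2]
    exact stationary_zero_mul hP hErg hpi hstat hu hsum

end StarLink

/-! ### Construction of the quasi-link. -/

theorem theorem3p10 (n : ℕ) (P : Matrix (Fin (n + 1)) (Fin (n + 1)) ℝ) (pi : Fin (n + 1) → ℝ)
    -- `P` is the transition matrix of an ergodic (irreducible and aperiodic) chain on `{0, …, n}`
    (hP : P ∈ Matrix.rowStochastic ℝ (Fin (n + 1))) (hErg : P.IsPrimitive)
    -- `pi` is its stationary distribution, and the chain is time-reversible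
    (hpi : pi ∈ stdSimplex ℝ (Fin (n + 1))) (hstat : Matrix.vecMul pi P = pi)
    (hrev : ∀ i j, pi i * P i j = pi j * P j i)
    -- the smallest reduced eigenvalue `λ_r` of `P` is nonnegative
    (hlam : 0 ≤ StarLink.redLambda P (Fin.last (StarLink.numRed P))) :
    ∃ L : Matrix (Fin (StarLink.numRed P + 1)) (Fin (n + 1)) ℝ,
      StarLink.IsQuasiIntertwining pi (StarLink.absorb P)
        (StarLink.starPi (StarLink.redLambda P) (StarLink.redGamma P))
        (StarLink.absorb (StarLink.starP (StarLink.redLambda P) (StarLink.redGamma P))) L ∧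
      Matrix.mulVec L (Pi.single 0 1) = Pi.single 0 1 ∧
      -- row `0` is `δ₀`, and row `i ≥ 1` is `δ₀ + (-v·1 | v)` with `v` a left eigenvector of `P₀`
      -- for the eigenvalue `γ_i`
      L 0 = Pi.single 0 1 ∧
      ∀ i : Fin (StarLink.numRed P), ∃ v : Fin n → ℝ,
        v ≠ 0 ∧ Matrix.vecMul v (StarLink.delZero P) = StarLink.redGamma P i • v ∧
        L i.succ = Pi.single 0 1 + Fin.cons (-∑ j, v j) v := by
  obtain ⟨G, u, hu, hsum⟩ :=
    StarLink.exists_left_eigenvector_decomposition (StarLink.stationary_pos hErg hpi hstat) hrev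
  obtain ⟨hred0, hstar0, hstar⟩ :=
    StarLink.starPi_redLambda_redGamma hP hErg hpi hstat hrev hu hsum
  set γ := StarLink.redGamma P with hγ
  have hG := StarLink.map_redGamma hred0
  have hinj := StarLink.redGamma_injective hred0
  have hmem : ∀ i, γ i ∈ G := fun i => by
    rw [← hG]; exact Finset.mem_map_of_mem ⟨γ, hinj⟩ (Finset.mem_univ i)
  have hone : ∀ i, 1 - γ i ≠ 0 := fun i =>
    sub_ne_zero.2 (StarLink.ne_one_of_pos hP (hu _ (hmem i)).1 (hu _ (hmem i)).2).symm
  set W : Fin (StarLink.numRed P) → ℝ := fun i => u (γ i) ⬝ᵥ fun j => P j.succ 0 with hW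
  have hWpos : ∀ i, 0 < W i := fun i => (hu _ (hmem i)).2
  -- The eigenvector `u (γ i)` has total mass `W i / (1 - γ i)`; scaling it to mass one makes column
  -- `0` of `L` vanish below row `0`.
  set v : Fin (StarLink.numRed P) → Fin n → ℝ := fun i => ((1 - γ i) / W i) • u (γ i) with hv
  have hvP : ∀ i, Matrix.vecMul (v i) (StarLink.delZero P) = γ i • v i := fun i => by
    rw [hv, Matrix.smul_vecMul, (hu _ (hmem i)).1, smul_comm]
  have hv1 : ∀ i, ∑ j, v i j = 1 := fun i => by
    have h := StarLink.sum_mul_one_sub hP (hu _ (hmem i)).1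
    change _ = W i at h
    have := (hWpos i).ne'
    simp only [hv, Pi.smul_apply, smul_eq_mul, ← Finset.mul_sum]
    rw [div_mul_eq_mul_div, mul_comm, h, div_self this]
  set L : Matrix (Fin (StarLink.numRed P + 1)) (Fin (n + 1)) ℝ :=
    Matrix.of (Fin.cons (Pi.single 0 1) fun i => Pi.single 0 1 + Fin.cons (-∑ j, v i j) (v i))
    with hL
  have hL0 : L 0 = Pi.single 0 1 := rfl
  have hLs : ∀ i : Fin (StarLink.numRed P),
      L i.succ = Pi.single 0 1 + Fin.cons (-∑ j, v i j) (v i) := fun i => rfl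
  have hLs0 : ∀ i : Fin (StarLink.numRed P), L i.succ 0 = 0 := fun i => by simp [hLs, hv1]
  refine ⟨L, ⟨fun i => ?_, ?_, ?_⟩, ?_, hL0, fun i => ⟨v i, fun h => ?_, hvP i, hLs i⟩⟩
  · refine Fin.cases (by simp [hL0]) (fun i => ?_) i
    rw [Fin.sum_univ_succ, hLs0]
    simp [hLs, hv1]
  · funext i
    rw [Matrix.mul_apply_eq_vecMul, Matrix.mul_apply_eq_vecMul]
    refine Fin.cases ?_ (fun i => ?_) i
    · rw [hL0, StarLink.absorb, StarLink.absorb, Matrix.updateRow_self, Matrix.single_one_vecMul,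
        Matrix.single_one_vecMul, Matrix.row, Matrix.updateRow_self, Matrix.row, hL0]
    · rw [hLs, StarLink.vecMul_absorb_of_eigenvector hP (hvP i), ← hLs, StarLink.absorb,
        Matrix.updateRow_ne (Fin.succ_ne_zero i)]
      funext k
      simp [Matrix.vecMul, dotProduct, Fin.sum_univ_succ, StarLink.starP, hL0, hγ]
  · funext k
    rw [Matrix.vecMul, dotProduct, Fin.sum_univ_succ, hL0, hstar0]
    refine Fin.cases ?_ (fun k => ?_) k
    · simp [hLs0]
    · have hsumG : ∀ f : ℝ → ℝ, ∑ g ∈ G, f g = ∑ i, f (γ i) := fun f => by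
        conv_lhs => rw [← hG]
        rw [Finset.sum_map]; rfl
      rw [StarLink.stationary_eq_sum hP hErg hstat hu hsum, hsumG fun g => pi 0 / (1 - g) * u g k]
      simp only [hLs, hstar, Pi.add_apply, Fin.cons_succ, Pi.single_eq_of_ne (Fin.succ_ne_zero k),
        mul_zero, zero_add]
      refine Finset.sum_congr rfl fun i _ => ?_
      have := (hWpos i).ne'
      have := hone i
      -- The scaling cancels `W i` and one factor `1 - γ i` of `π*(i)`, leaving the coefficient
      -- `π(0) / (1 - γ i)` of the stationary expansion.
      change _ = pi 0 * W i / (1 - γ i) ^ 2 * ((1 - γ i) / W i * u (γ i) k)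
      field_simp
  · rw [Matrix.mulVec_single_one]
    funext i
    refine Fin.cases (by simp [hL0]) (fun i => ?_) i
    simp [hLs0]
  · have := hv1 i
    simp [h] at this
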